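/- Let $G$ be a compact (Hausdorff) group, $n\ge 0$, and $C(G)$ the C*-algebra of continuous functions $G\to\mathbb C$, with its natural operator space structure: the norm of $A\in M_{p,q}(C(G))$ is $\sup_{s\in G}\|A(s)\|$, where $\|A(s)\|$ is the norm of $A(s)$ as an operator from the Hilbert space $\mathbb C^q$ to the Hilbert space $\mathbb C^p$. For operator spaces $X,Y$, the Haagerup norm of $U\in M_{p,q}(X\otimes Y)$ is $$\|U\|_h=\inf\{\|x\|\,\|y\| : U=x\odot y,\ x\in M_{p,r}(X),\ y\in M_{r,q}(Y),\ r\in\mathbb N\},\qquad (x\odot y)_{ij}=\sum_k x_{ik}\otimes y_{kj}.$$ Let $V^n(G)=\otimes^h_{n+1}C(G)$ be the $(n+1)$-fold Haagerup tensor product, i.e. the completion of the algebraic tensor product $C(G)\otimes\cdots\otimes C(G)$ of $n+1$ copies of $C(G)$ in the norm obtained by iterating this construction. Then $V^n(G)$ is, with pointwise addition and multiplication of functions on $G^{n+1}$, a commutative Banach algebra. That is: there is an injective continuous linear map from $V^n(G)$ to $C(G^{n+1})$ that sends each elementary tensor $\varphi_0\otimes\cdots\otimes\varphi_n$ to the function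 $(s_0,\dots,s_n)\mapsto\varphi_0(s_0)\cdots\varphi_n(s_n)$; its image is a subalgebra of $C(G^{n+1})$ containing the constants; and when $V^n(G)$ is identified with this image, the (complete) norm of $V^n(G)$ satisfies $\|uv\|\le\|u\|\,\|v\|$ for all $u,v\in V^n(G)$. -/

import Mathlib

open scoped TensorProduct

universe u

namespace Varopoulos

noncomputable section

/-! ### Operator spaces -/

/-- The operator norm of a complex `p × q` matrix, acting between the Euclidean (Hilbert) spaces
`ℂ^q` and `ℂ^p`. -/
def opNorm {p q : ℕ} (α : Matrix (Fin p) (Fin q) ℂ) : ℝ :=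
  ‖LinearMap.toContinuousLinearMap (Matrix.toEuclideanLin α)‖

/-- The product `α x β` of a matrix `x` over a complex vector space with scalar matrices. -/
def scalarMul {X : Type u} [AddCommGroup X] [Module ℂ X] {p p' q q' : ℕ}
    (α : Matrix (Fin p') (Fin p) ℂ) (x : Matrix (Fin p) (Fin q) X)
    (β : Matrix (Fin q) (Fin q') ℂ) : Matrix (Fin p') (Fin q') X :=
  fun i j => ∑ k, ∑ l, (α i k * β l j) • x k l

/-- The block diagonal matrix `x ⊕ y`. -/
def directSum {X : Type u} [AddCommGroup X] {p q p' q' : ℕ}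
    (x : Matrix (Fin p) (Fin q) X) (y : Matrix (Fin p') (Fin q') X) :
    Matrix (Fin (p + p')) (Fin (q + q')) X :=
  Matrix.reindex finSumFinEquiv finSumFinEquiv (Matrix.fromBlocks x 0 0 y)

/-- An operator space (not assumed to be complete, and whose matrix norms are a priori only
seminorms): a complex vector space with a (semi)norm on each space of rectangular matrices
`M_{p,q}(X)`, subject to Ruan's axioms. The inequality opposite to `mnorm_directSum_le` follows
from `mnorm_scalarMul_le`, and so does the fact that every `mnorm` is a seminorm. -/
structure OpSpace : Type (u + 1) where
  carrier : Type u
  [addCommGroup : AddCommGroup carrier]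
  [module : Module ℂ carrier]
  mnorm : ∀ {p q : ℕ}, Matrix (Fin p) (Fin q) carrier → ℝ
  mnorm_nonneg : ∀ {p q : ℕ} (x : Matrix (Fin p) (Fin q) carrier), 0 ≤ mnorm x
  mnorm_directSum_le : ∀ {p q p' q' : ℕ} (x : Matrix (Fin p) (Fin q) carrier)
    (y : Matrix (Fin p') (Fin q') carrier), mnorm (directSum x y) ≤ max (mnorm x) (mnorm y)
  mnorm_scalarMul_le : ∀ {p p' q q' : ℕ} (α : Matrix (Fin p') (Fin p) ℂ)
    (x : Matrix (Fin p) (Fin q) carrier) (β : Matrix (Fin q) (Fin q') ℂ),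
    mnorm (scalarMul α x β) ≤ opNorm α * mnorm x * opNorm β

attribute [instance] OpSpace.addCommGroup OpSpace.module

/-! ### Auxiliary facts on scalar matrices and blocks -/

theorem opNorm_nonneg {p q : ℕ} (α : Matrix (Fin p) (Fin q) ℂ) : 0 ≤ opNorm α := norm_nonneg _

open scoped Matrix.Norms.L2Operator in
theorem opNorm_eq {p q : ℕ} (α : Matrix (Fin p) (Fin q) ℂ) : opNorm α = ‖α‖ := rfl

theorem opNorm_smul_one_le {p : ℕ} (c : ℂ) :
    opNorm (c • (1 : Matrix (Fin p) (Fin p) ℂ)) ≤ ‖c‖ := by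
  refine ContinuousLinearMap.opNorm_le_bound _ (norm_nonneg _) fun v => ?_
  have : (LinearMap.toContinuousLinearMap
      (Matrix.toEuclideanLin (c • (1 : Matrix (Fin p) (Fin p) ℂ)))) v = c • v := by
    ext i
    simp [Matrix.toEuclideanLin]
  rw [this, norm_smul]

theorem opNorm_one_le {p : ℕ} : opNorm (1 : Matrix (Fin p) (Fin p) ℂ) ≤ 1 := by
  simpa using opNorm_smul_one_le (p := p) 1

theorem opNorm_le_of_sq {p q : ℕ} (α : Matrix (Fin p) (Fin q) ℂ) (C : ℝ) (hC : 0 ≤ C)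
    (h : ∀ v : Fin q → ℂ, ∑ i, ‖α.mulVec v i‖ ^ 2 ≤ C ^ 2 * ∑ j, ‖v j‖ ^ 2) : opNorm α ≤ C := by
  refine ContinuousLinearMap.opNorm_le_bound _ hC fun v => ?_
  refine le_of_sq_le_sq ?_ (by positivity)
  rw [mul_pow, EuclideanSpace.norm_sq_eq, EuclideanSpace.norm_sq_eq]
  exact h v

theorem sq_le_opNorm {p q : ℕ} (α : Matrix (Fin p) (Fin q) ℂ) (v : Fin q → ℂ) :
    ∑ i, ‖α.mulVec v i‖ ^ 2 ≤ opNorm α ^ 2 * ∑ j, ‖v j‖ ^ 2 := by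
  have h := (LinearMap.toContinuousLinearMap (Matrix.toEuclideanLin α)).le_opNorm (WithLp.toLp 2 v)
  have h2 := pow_le_pow_left₀ (norm_nonneg _) h 2
  rw [mul_pow, EuclideanSpace.norm_sq_eq, EuclideanSpace.norm_sq_eq] at h2
  exact h2

section blocks

variable {X : Type u} [AddCommGroup X] {p q p' q' : ℕ}
  (x : Matrix (Fin p) (Fin q) X) (y : Matrix (Fin p') (Fin q') X)

@[simp] theorem directSum_ll (i : Fin p) (j : Fin q) :
    directSum x y (Fin.castAdd p' i) (Fin.castAdd q' j) = x i j := by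
  simp [directSum]

@[simp] theorem directSum_lr (i : Fin p) (j : Fin q') :
    directSum x y (Fin.castAdd p' i) (Fin.natAdd q j) = 0 := by
  simp [directSum]

@[simp] theorem directSum_rl (i : Fin p') (j : Fin q) :
    directSum x y (Fin.natAdd p i) (Fin.castAdd q' j) = 0 := by
  simp [directSum]

@[simp] theorem directSum_rr (i : Fin p') (j : Fin q') :
    directSum x y (Fin.natAdd p i) (Fin.natAdd q j) = y i j := by
  simp [directSum]

end blocks

theorem opNorm_directSum_le {p q p' q' : ℕ} (x : Matrix (Fin p) (Fin q) ℂ)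
    (y : Matrix (Fin p') (Fin q') ℂ) : opNorm (directSum x y) ≤ max (opNorm x) (opNorm y) := by
  refine opNorm_le_of_sq _ _ (le_max_of_le_left (opNorm_nonneg _)) fun v => ?_
  have h1 := sq_le_opNorm x (fun j => v (Fin.castAdd q' j))
  have h2 := sq_le_opNorm y (fun j => v (Fin.natAdd q j))
  have k1 : opNorm x ^ 2 ≤ max (opNorm x) (opNorm y) ^ 2 :=
    pow_le_pow_left₀ (opNorm_nonneg _) (le_max_left _ _) 2
  have k2 : opNorm y ^ 2 ≤ max (opNorm x) (opNorm y) ^ 2 :=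
    pow_le_pow_left₀ (opNorm_nonneg _) (le_max_right _ _) 2
  have e1 : ∀ i, (directSum x y).mulVec v (Fin.castAdd p' i)
      = x.mulVec (fun j => v (Fin.castAdd q' j)) i := fun i => by
    simp [Matrix.mulVec, dotProduct, Fin.sum_univ_add]
  have e2 : ∀ i, (directSum x y).mulVec v (Fin.natAdd p i)
      = y.mulVec (fun j => v (Fin.natAdd q j)) i := fun i => by
    simp [Matrix.mulVec, dotProduct, Fin.sum_univ_add]
  rw [Fin.sum_univ_add, Fin.sum_univ_add, mul_add]
  simp only [e1, e2]
  refine add_le_add (h1.trans ?_) (h2.trans ?_)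
  · exact mul_le_mul_of_nonneg_right k1 (by positivity)
  · exact mul_le_mul_of_nonneg_right k2 (by positivity)

theorem scalarMul_smul_one {X : Type u} [AddCommGroup X] [Module ℂ X] {p q : ℕ}
    (c : ℂ) (x : Matrix (Fin p) (Fin q) X) :
    scalarMul (c • (1 : Matrix (Fin p) (Fin p) ℂ)) x 1 = c • x := by
  ext i j
  simp only [scalarMul, Matrix.smul_apply, Matrix.one_apply, smul_eq_mul]
  rw [Finset.sum_eq_single i, Finset.sum_eq_single j]
  · simp
  · intro b _ hb; simp [hb]
  · simp
  · intro b _ hb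
    exact Finset.sum_eq_zero fun l _ => by simp [hb.symm]
  · simp

/-! ### The norm on an operator space -/

namespace OpSpace

variable (E : OpSpace.{u})

theorem mnorm_smul_le {p q : ℕ} (c : ℂ) (x : Matrix (Fin p) (Fin q) E.carrier) :
    E.mnorm (c • x) ≤ ‖c‖ * E.mnorm x := by
  rw [← scalarMul_smul_one]
  refine (E.mnorm_scalarMul_le _ _ _).trans ?_
  calc opNorm (c • (1 : Matrix (Fin p) (Fin p) ℂ)) * E.mnorm x * opNorm 1
      ≤ ‖c‖ * E.mnorm x * 1 := by
        refine mul_le_mul ?_ opNorm_one_le (opNorm_nonneg _) ?_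
        · exact mul_le_mul_of_nonneg_right (opNorm_smul_one_le c) (E.mnorm_nonneg _)
        · exact mul_nonneg (norm_nonneg _) (E.mnorm_nonneg _)
    _ = _ := mul_one _

theorem mnorm_smul {p q : ℕ} (c : ℂ) (x : Matrix (Fin p) (Fin q) E.carrier) :
    E.mnorm (c • x) = ‖c‖ * E.mnorm x := by
  refine le_antisymm (E.mnorm_smul_le c x) ?_
  rcases eq_or_ne c 0 with rfl | hc
  · simpa using E.mnorm_nonneg _
  · have h := E.mnorm_smul_le c⁻¹ (c • x)
    rw [smul_smul, inv_mul_cancel₀ hc, one_smul, norm_inv] at h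
    have hc' : 0 < ‖c‖ := norm_pos_iff.mpr hc
    calc ‖c‖ * E.mnorm x ≤ ‖c‖ * (‖c‖⁻¹ * E.mnorm (c • x)) :=
          mul_le_mul_of_nonneg_left h hc'.le
      _ = _ := by rw [← mul_assoc, mul_inv_cancel₀ hc'.ne', one_mul]

/-- An element of `X` as a `1 × 1` matrix. -/
def single {X : Type u} (a : X) : Matrix (Fin 1) (Fin 1) X := fun _ _ => a

theorem mnorm_single_add_le (a b : E.carrier) :
    E.mnorm (single (a + b)) ≤ E.mnorm (single a) + E.mnorm (single b) := by
  refine le_of_forall_pos_le_add fun ε hε => ?_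
  set c : ℝ := E.mnorm (single a) + ε / 2 with hc
  set d : ℝ := E.mnorm (single b) + ε / 2 with hd
  have hc0 : 0 < c := by have := E.mnorm_nonneg (single a); linarith
  have hd0 : 0 < d := by have := E.mnorm_nonneg (single b); linarith
  let R : Matrix (Fin 1) (Fin (1 + 1)) ℂ :=
    fun _ j => Fin.addCases (fun _ => ((√c : ℝ) : ℂ)) (fun _ => ((√d : ℝ) : ℂ)) j
  let C : Matrix (Fin (1 + 1)) (Fin 1) ℂ := fun i _ => R 0 i
  have hR : opNorm R ≤ √(c + d) := by
    refine opNorm_le_of_sq _ _ (Real.sqrt_nonneg _) fun v => ?_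
    rw [Real.sq_sqrt (by positivity)]
    have h0 : R.mulVec v 0 = (√c : ℝ) * v 0 + (√d : ℝ) * v 1 := by
      simp only [R, Matrix.mulVec, dotProduct, Fin.sum_univ_add, Fin.addCases_left,
        Fin.addCases_right, Fin.sum_univ_one]
      rfl
    have h1 : ‖R.mulVec v 0‖ ≤ √c * ‖v 0‖ + √d * ‖v 1‖ := by
      rw [h0]
      refine (norm_add_le _ _).trans ?_
      simp [abs_of_nonneg (Real.sqrt_nonneg _)]
    have h2 := pow_le_pow_left₀ (norm_nonneg _) h1 2
    have hsum : ∑ j : Fin (1 + 1), ‖v j‖ ^ 2 = ‖v 0‖ ^ 2 + ‖v 1‖ ^ 2 :=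
      Fin.sum_univ_two (fun j => ‖v j‖ ^ 2)
    rw [Fin.sum_univ_one, hsum]
    refine h2.trans ?_
    nlinarith [Real.sq_sqrt hc0.le, Real.sq_sqrt hd0.le,
      sq_nonneg (√c * ‖v 1‖ - √d * ‖v 0‖)]
  have hC : opNorm C ≤ √(c + d) := by
    refine opNorm_le_of_sq _ _ (Real.sqrt_nonneg _) fun v => ?_
    rw [Real.sq_sqrt (by positivity)]
    have h0 : ∀ i, C.mulVec v i = R 0 i * v 0 := fun i => by
      simp [C, Matrix.mulVec, dotProduct]
    have hsum : ∑ i : Fin (1 + 1), ‖C.mulVec v i‖ ^ 2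
        = ‖((√c : ℝ) : ℂ) * v 0‖ ^ 2 + ‖((√d : ℝ) : ℂ) * v 0‖ ^ 2 := by
      simp only [Fin.sum_univ_add, h0, R, Fin.addCases_left, Fin.addCases_right,
        Fin.sum_univ_one]
    rw [hsum, Fin.sum_univ_one]
    simp only [norm_mul, mul_pow, Complex.norm_real, Real.norm_eq_abs, sq_abs,
      Real.sq_sqrt hc0.le, Real.sq_sqrt hd0.le]
    linarith
  have key : single (a + b) = scalarMul R
      (directSum (((c⁻¹ : ℝ) : ℂ) • single a) (((d⁻¹ : ℝ) : ℂ) • single b)) C := by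
    ext i j
    have hc' : ((√c : ℝ) : ℂ) * ((√c : ℝ) : ℂ) * (c : ℂ)⁻¹ = 1 := by
      rw [← Complex.ofReal_mul, Real.mul_self_sqrt hc0.le]
      exact mul_inv_cancel₀ (by exact_mod_cast hc0.ne')
    have hd' : ((√d : ℝ) : ℂ) * ((√d : ℝ) : ℂ) * (d : ℂ)⁻¹ = 1 := by
      rw [← Complex.ofReal_mul, Real.mul_self_sqrt hd0.le]
      exact mul_inv_cancel₀ (by exact_mod_cast hd0.ne')
    simp only [scalarMul, Fin.sum_univ_add, directSum_ll, directSum_lr, directSum_rl,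
      directSum_rr, Matrix.smul_apply, C, R, Fin.addCases_left, Fin.addCases_right, single]
    simp [smul_smul, hc', hd']
  have hX : E.mnorm (directSum (((c⁻¹ : ℝ) : ℂ) • single a) (((d⁻¹ : ℝ) : ℂ) • single b)) ≤ 1 := by
    refine (E.mnorm_directSum_le _ _).trans (max_le ?_ ?_)
    · rw [mnorm_smul, Complex.norm_real, Real.norm_of_nonneg (by positivity),
        inv_mul_le_iff₀ hc0]
      linarith
    · rw [mnorm_smul, Complex.norm_real, Real.norm_of_nonneg (by positivity),
        inv_mul_le_iff₀ hd0]
      linarith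
  rw [key]
  refine (E.mnorm_scalarMul_le _ _ _).trans ?_
  calc _ ≤ √(c + d) * 1 * √(c + d) :=
        mul_le_mul (mul_le_mul hR hX (E.mnorm_nonneg _) (Real.sqrt_nonneg _)) hC
          (opNorm_nonneg _) (by positivity)
    _ = c + d := by rw [mul_one, Real.mul_self_sqrt (by positivity)]
    _ = _ := by rw [hc, hd]; ring

/-- The (semi)norm of an element of an operator space is its norm as a `1 × 1` matrix. -/
instance : Norm E.carrier := ⟨fun a => E.mnorm (single a)⟩

theorem core : SeminormedSpace.Core ℂ E.carrier where
  norm_nonneg _ := E.mnorm_nonneg _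
  norm_smul c x := E.mnorm_smul c (single x)
  norm_triangle x y := E.mnorm_single_add_le x y

instance : SeminormedAddCommGroup E.carrier := SeminormedAddCommGroup.ofCore E.core

instance : NormedSpace ℂ E.carrier where
  norm_smul_le c x := E.mnorm_smul_le c (single x)

end OpSpace

/-! ### The operator space `C(K)` -/

section CK

variable (K : Type u) [TopologicalSpace K] [CompactSpace K]

/-- A matrix of continuous functions as a continuous matrix-valued function. -/
def evalMatrix {K : Type u} [TopologicalSpace K] {p q : ℕ} (A : Matrix (Fin p) (Fin q) C(K, ℂ)) :
    C(K, Matrix (Fin p) (Fin q) ℂ) where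
  toFun s := A.map fun f => f s
  continuous_toFun := by
    refine continuous_matrix fun i j => ?_
    exact (A i j).continuous

open scoped Matrix.Norms.L2Operator in
/-- The norm of `M_{p,q}(C(K)) = C(K, M_{p,q}(ℂ))`, i.e. the supremum over `s ∈ K` of the operator
norms of the matrices `A(s)`. -/
def matrixSupNorm {K : Type u} [TopologicalSpace K] [CompactSpace K] {p q : ℕ}
    (A : Matrix (Fin p) (Fin q) C(K, ℂ)) : ℝ :=
  ‖evalMatrix A‖

open scoped Matrix.Norms.L2Operator in
theorem matrixSupNorm_nonneg {p q : ℕ} (A : Matrix (Fin p) (Fin q) C(K, ℂ)) :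
    0 ≤ matrixSupNorm A := norm_nonneg (evalMatrix A)

open scoped Matrix.Norms.L2Operator in
theorem opNorm_evalMatrix_le {p q : ℕ} (A : Matrix (Fin p) (Fin q) C(K, ℂ)) (s : K) :
    opNorm (evalMatrix A s) ≤ matrixSupNorm A := (evalMatrix A).norm_coe_le_norm s

open scoped Matrix.Norms.L2Operator in
theorem matrixSupNorm_le {p q : ℕ} (A : Matrix (Fin p) (Fin q) C(K, ℂ)) {c : ℝ} (hc : 0 ≤ c)
    (h : ∀ s, opNorm (evalMatrix A s) ≤ c) : matrixSupNorm A ≤ c :=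
  (ContinuousMap.norm_le _ hc).mpr h

/-- The C*-algebra `C(K)` with its natural operator space structure. -/
def continuousOpSpace : OpSpace.{u} where
  carrier := C(K, ℂ)
  mnorm := matrixSupNorm
  mnorm_nonneg := matrixSupNorm_nonneg K
  mnorm_directSum_le x y := by
    refine matrixSupNorm_le K _ (le_max_of_le_left (matrixSupNorm_nonneg K x)) fun s => ?_
    have : evalMatrix (directSum x y) s = directSum (evalMatrix x s) (evalMatrix y s) := by
      ext i j
      refine Fin.addCases (fun i => ?_) (fun i => ?_) i <;>
        refine Fin.addCases (fun j => ?_) (fun j => ?_) j <;>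
        simp [evalMatrix]
    rw [this]
    exact (opNorm_directSum_le _ _).trans
      (max_le_max (opNorm_evalMatrix_le K x s) (opNorm_evalMatrix_le K y s))
  mnorm_scalarMul_le α x β := by
    refine matrixSupNorm_le K _ (mul_nonneg (mul_nonneg (opNorm_nonneg _)
      (matrixSupNorm_nonneg K x)) (opNorm_nonneg _)) fun s => ?_
    have : evalMatrix (scalarMul α x β) s = α * evalMatrix x s * β := by
      ext i j
      simp only [evalMatrix, scalarMul, ContinuousMap.coe_mk, Matrix.map_apply, Matrix.mul_apply,
        ContinuousMap.coe_sum, Finset.sum_apply, ContinuousMap.coe_smul, Pi.smul_apply,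
        smul_eq_mul, Finset.sum_mul]
      rw [Finset.sum_comm]
      refine Finset.sum_congr rfl fun l _ => Finset.sum_congr rfl fun k _ => by ring
    rw [this]
    have h1 : opNorm (α * evalMatrix x s * β)
        ≤ opNorm α * opNorm (evalMatrix x s) * opNorm β := by
      refine (Matrix.l2_opNorm_mul _ _).trans ?_
      exact mul_le_mul_of_nonneg_right (Matrix.l2_opNorm_mul _ _) (opNorm_nonneg _)
    refine h1.trans ?_
    exact mul_le_mul_of_nonneg_right
      (mul_le_mul_of_nonneg_left (opNorm_evalMatrix_le K x s) (opNorm_nonneg _)) (opNorm_nonneg _)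

end CK

/-! ### The Haagerup tensor product -/

section Haagerup

/-- The product `x ⊙ y` with entries `∑ k, x i k ⊗ y k j`. -/
def odot {X Y : Type u} [AddCommGroup X] [Module ℂ X] [AddCommGroup Y] [Module ℂ Y] {p r q : ℕ}
    (x : Matrix (Fin p) (Fin r) X) (y : Matrix (Fin r) (Fin q) Y) :
    Matrix (Fin p) (Fin q) (X ⊗[ℂ] Y) :=
  fun i j => ∑ k, x i k ⊗ₜ[ℂ] y k j

variable (E F : OpSpace.{u})

/-- The Haagerup tensor norm of `U ∈ M_{p,q}(E ⊗ F)`: the infimum of `‖x‖ ‖y‖` over all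
factorizations `U = x ⊙ y` with `x ∈ M_{p,r}(E)`, `y ∈ M_{r,q}(F)` and `r ∈ ℕ`. -/
def haagerupNorm {p q : ℕ} (U : Matrix (Fin p) (Fin q) (E.carrier ⊗[ℂ] F.carrier)) : ℝ :=
  sInf {c | ∃ (r : ℕ) (x : Matrix (Fin p) (Fin r) E.carrier)
    (y : Matrix (Fin r) (Fin q) F.carrier), U = odot x y ∧ c = E.mnorm x * F.mnorm y}

variable {E F}

theorem haagerupNorm_odot_le {p r q : ℕ} (x : Matrix (Fin p) (Fin r) E.carrier)
    (y : Matrix (Fin r) (Fin q) F.carrier) :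
    haagerupNorm E F (odot x y) ≤ E.mnorm x * F.mnorm y := by
  refine csInf_le ⟨0, ?_⟩ ⟨r, x, y, rfl, rfl⟩
  rintro c ⟨r, x, y, -, rfl⟩
  exact mul_nonneg (E.mnorm_nonneg _) (F.mnorm_nonneg _)

theorem haagerupNorm_nonneg {p q : ℕ} (U : Matrix (Fin p) (Fin q) (E.carrier ⊗[ℂ] F.carrier)) :
    0 ≤ haagerupNorm E F U := by
  refine Real.sInf_nonneg ?_
  rintro c ⟨r, x, y, -, rfl⟩
  exact mul_nonneg (E.mnorm_nonneg _) (F.mnorm_nonneg _)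

theorem exists_odot {p q : ℕ} (U : Matrix (Fin p) (Fin q) (E.carrier ⊗[ℂ] F.carrier)) :
    ∃ (r : ℕ) (x : Matrix (Fin p) (Fin r) E.carrier) (y : Matrix (Fin r) (Fin q) F.carrier),
      U = odot x y := by
  have hadd : ∀ U V : Matrix (Fin p) (Fin q) (E.carrier ⊗[ℂ] F.carrier),
      (∃ (r : ℕ) (x : Matrix (Fin p) (Fin r) E.carrier) (y : Matrix (Fin r) (Fin q) F.carrier),
        U = odot x y) →
      (∃ (r : ℕ) (x : Matrix (Fin p) (Fin r) E.carrier) (y : Matrix (Fin r) (Fin q) F.carrier),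
        V = odot x y) →
      ∃ (r : ℕ) (x : Matrix (Fin p) (Fin r) E.carrier) (y : Matrix (Fin r) (Fin q) F.carrier),
        U + V = odot x y := by
    rintro _ _ ⟨r, x, y, rfl⟩ ⟨s, z, w, rfl⟩
    refine ⟨r + s, fun i => Fin.addCases (x i) (z i),
      fun k j => Fin.addCases (fun k => y k j) (fun k => w k j) k, ?_⟩
    ext i j
    simp [odot, Fin.sum_univ_add]
  have hzero : ∃ (r : ℕ) (x : Matrix (Fin p) (Fin r) E.carrier)
      (y : Matrix (Fin r) (Fin q) F.carrier),
      (0 : Matrix (Fin p) (Fin q) (E.carrier ⊗[ℂ] F.carrier)) = odot x y :=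
    ⟨0, 0, 0, by ext i j; simp [odot]⟩
  have hsum : ∀ {ι : Type} (S : Finset ι)
      (f : ι → Matrix (Fin p) (Fin q) (E.carrier ⊗[ℂ] F.carrier)),
      (∀ i ∈ S, ∃ (r : ℕ) (x : Matrix (Fin p) (Fin r) E.carrier)
        (y : Matrix (Fin r) (Fin q) F.carrier), f i = odot x y) →
      ∃ (r : ℕ) (x : Matrix (Fin p) (Fin r) E.carrier) (y : Matrix (Fin r) (Fin q) F.carrier),
        ∑ i ∈ S, f i = odot x y := fun S f hf =>
    Finset.sum_induction f (fun V => ∃ (r : ℕ) (x : Matrix (Fin p) (Fin r) E.carrier)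
        (y : Matrix (Fin r) (Fin q) F.carrier), V = odot x y) hadd hzero hf
  rw [Matrix.matrix_eq_sum_single U]
  refine hsum _ _ fun i _ => hsum _ _ fun j _ => ?_
  induction U i j using TensorProduct.induction_on with
  | zero => simp only [Matrix.single_zero]; exact hzero
  | add a b ha hb =>
    rw [Matrix.single_add]
    exact hadd _ _ ha hb
  | tmul a b =>
    refine ⟨1, fun i' _ => if i' = i then a else 0, fun _ j' => if j' = j then b else 0, ?_⟩
    ext i' j'
    by_cases hi : i' = i <;> by_cases hj : j' = j <;>
      simp [odot, hi, hj, Ne.symm]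

theorem exists_scaling {a b c : ℝ} (ha : 0 ≤ a) (hb : 0 ≤ b) (h : a * b < c) :
    ∃ t : ℝ, 0 < t ∧ t * a ≤ √c ∧ t⁻¹ * b ≤ √c := by
  have hc : 0 < c := (mul_nonneg ha hb).trans_lt h
  have hs : 0 < √c := Real.sqrt_pos.mpr hc
  rcases ha.eq_or_lt with rfl | ha
  · refine ⟨(b + 1) / √c, by positivity, by simp, ?_⟩
    rw [inv_div, div_mul_eq_mul_div, div_le_iff₀ (by positivity)]
    nlinarith
  · refine ⟨√c / a, by positivity, by rw [div_mul_cancel₀ _ ha.ne'], ?_⟩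
    rw [inv_div, div_mul_eq_mul_div, div_le_iff₀ hs, Real.mul_self_sqrt hc.le]
    exact h.le

theorem exists_odot_of_lt {p q : ℕ} {U : Matrix (Fin p) (Fin q) (E.carrier ⊗[ℂ] F.carrier)}
    {c : ℝ} (h : haagerupNorm E F U < c) :
    ∃ (r : ℕ) (x : Matrix (Fin p) (Fin r) E.carrier) (y : Matrix (Fin r) (Fin q) F.carrier),
      U = odot x y ∧ E.mnorm x ≤ √c ∧ F.mnorm y ≤ √c := by
  obtain ⟨r₀, x₀, y₀, h₀⟩ := exists_odot U
  obtain ⟨_, ⟨r, x, y, rfl, rfl⟩, hlt⟩ := exists_lt_of_csInf_lt (by exact ⟨_, r₀, x₀, y₀, h₀, rfl⟩) h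
  obtain ⟨t, ht, h1, h2⟩ := exists_scaling (E.mnorm_nonneg x) (F.mnorm_nonneg y) hlt
  refine ⟨r, (t : ℂ) • x, ((t⁻¹ : ℝ) : ℂ) • y, ?_, ?_, ?_⟩
  · ext i j
    refine Finset.sum_congr rfl fun k _ => ?_
    have : (t : ℂ) ≠ 0 := by exact_mod_cast ht.ne'
    rw [Matrix.smul_apply, Matrix.smul_apply, TensorProduct.smul_tmul_smul, Complex.ofReal_inv,
      mul_inv_cancel₀ this, one_smul]
  · rwa [OpSpace.mnorm_smul, Complex.norm_real, Real.norm_of_nonneg ht.le]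
  · rwa [OpSpace.mnorm_smul, Complex.norm_real, Real.norm_of_nonneg (inv_pos.mpr ht).le]

variable (E F)

/-- The (algebraic) tensor product of two operator spaces with the Haagerup tensor norms. -/
def haagerup : OpSpace.{u} where
  carrier := E.carrier ⊗[ℂ] F.carrier
  mnorm := haagerupNorm E F
  mnorm_nonneg := haagerupNorm_nonneg
  mnorm_directSum_le U V := by
    refine le_of_forall_gt_imp_ge_of_dense fun c hc => ?_
    obtain ⟨r, x, y, rfl, hx, hy⟩ := exists_odot_of_lt ((le_max_left _ _).trans_lt hc)
    obtain ⟨s, z, w, rfl, hz, hw⟩ := exists_odot_of_lt ((le_max_right _ _).trans_lt hc)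
    have : directSum (odot x y) (odot z w) = odot (directSum x z) (directSum y w) := by
      ext i j
      refine Fin.addCases (fun i => ?_) (fun i => ?_) i <;>
        refine Fin.addCases (fun j => ?_) (fun j => ?_) j <;>
        simp [odot, Fin.sum_univ_add]
    rw [this]
    refine (haagerupNorm_odot_le _ _).trans ?_
    calc _ ≤ √c * √c := mul_le_mul ((E.mnorm_directSum_le _ _).trans (max_le hx hz))
          ((F.mnorm_directSum_le _ _).trans (max_le hy hw)) (F.mnorm_nonneg _) (Real.sqrt_nonneg _)
      _ = c := Real.mul_self_sqrt
          ((le_max_of_le_left (haagerupNorm_nonneg _)).trans hc.le)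
  mnorm_scalarMul_le {p p' q q'} α U β := by
    have hne : ({c | ∃ (r : ℕ) (x : Matrix (Fin p) (Fin r) E.carrier)
        (y : Matrix (Fin r) (Fin q) F.carrier), U = odot x y ∧
          c = E.mnorm x * F.mnorm y}).Nonempty := by
      obtain ⟨r, x, y, h⟩ := exists_odot U
      exact ⟨_, r, x, y, h, rfl⟩
    have hstep : ∀ c, haagerupNorm E F U < c →
        haagerupNorm E F (scalarMul α U β) ≤ opNorm α * c * opNorm β := by
      intro c hc
      obtain ⟨_, ⟨r, x, y, rfl, rfl⟩, hlt⟩ := exists_lt_of_csInf_lt hne hc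
      have : scalarMul α (odot x y) β = odot (scalarMul α x (1 : Matrix (Fin r) (Fin r) ℂ))
          (scalarMul (1 : Matrix (Fin r) (Fin r) ℂ) y β) := by
        ext i j
        have e1 : ∀ k, scalarMul α x (1 : Matrix (Fin r) (Fin r) ℂ) i k
            = ∑ a, α i a • x a k := fun k => by
          simp [scalarMul, Matrix.one_apply]
        have e2 : ∀ k, scalarMul (1 : Matrix (Fin r) (Fin r) ℂ) y β k j
            = ∑ b, β b j • y k b := fun k => by
          simp only [scalarMul, Matrix.one_apply]
          rw [Finset.sum_eq_single k]
          · simp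
          · intro b _ hb; simp [hb.symm]
          · simp
        have e3 : ∀ k, (∑ a, α i a • x a k) ⊗ₜ[ℂ] (∑ b, β b j • y k b)
            = ∑ a, ∑ b, (α i a * β b j) • (x a k ⊗ₜ[ℂ] y k b) := fun k => by
          rw [TensorProduct.sum_tmul]
          refine Finset.sum_congr rfl fun a _ => ?_
          rw [TensorProduct.tmul_sum]
          exact Finset.sum_congr rfl fun b _ => TensorProduct.smul_tmul_smul _ _ _ _
        simp only [odot, e1, e2, e3]
        simp only [scalarMul]
        rw [Finset.sum_comm (s := (Finset.univ : Finset (Fin r)))]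
        refine Finset.sum_congr rfl fun a _ => ?_
        rw [Finset.sum_comm]
        exact Finset.sum_congr rfl fun b _ => Finset.smul_sum
      rw [this]
      refine (haagerupNorm_odot_le _ _).trans ?_
      have h1 : E.mnorm (scalarMul α x (1 : Matrix (Fin r) (Fin r) ℂ)) ≤ opNorm α * E.mnorm x :=
        (E.mnorm_scalarMul_le α x 1).trans (mul_le_of_le_one_right
          (mul_nonneg (opNorm_nonneg _) (E.mnorm_nonneg _)) opNorm_one_le)
      have h2 : F.mnorm (scalarMul (1 : Matrix (Fin r) (Fin r) ℂ) y β) ≤ F.mnorm y * opNorm β :=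
        (F.mnorm_scalarMul_le 1 y β).trans (mul_le_mul_of_nonneg_right
          (mul_le_of_le_one_left (F.mnorm_nonneg _) opNorm_one_le) (opNorm_nonneg _))
      calc _ ≤ (opNorm α * E.mnorm x) * (F.mnorm y * opNorm β) :=
            mul_le_mul h1 h2 (F.mnorm_nonneg _)
              (mul_nonneg (opNorm_nonneg _) (E.mnorm_nonneg _))
        _ = opNorm α * (E.mnorm x * F.mnorm y) * opNorm β := by ring
        _ ≤ _ := mul_le_mul_of_nonneg_right
            (mul_le_mul_of_nonneg_left hlt.le (opNorm_nonneg _)) (opNorm_nonneg _)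
    have hlim : Filter.Tendsto (fun c : ℝ => opNorm α * c * opNorm β)
        (nhdsWithin (haagerupNorm E F U) (Set.Ioi (haagerupNorm E F U)))
        (nhds (opNorm α * haagerupNorm E F U * opNorm β)) :=
      ((continuous_const.mul continuous_id).mul continuous_const).continuousWithinAt
    exact ge_of_tendsto hlim (eventually_nhdsWithin_of_forall fun c hc => hstep c hc)

end Haagerup

/-! ### The multidimensional Varopoulos algebra -/

section V

variable (n : ℕ) (G : Type u) [TopologicalSpace G] [CompactSpace G]

/-- The algebraic tensor product `C(G) ⊗ ⋯ ⊗ C(G)` of `n + 1` copies of `C(G)`, with the (iterated)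
Haagerup tensor norms. -/
def haagerupPower : ℕ → OpSpace.{u}
  | 0 => continuousOpSpace G
  | n + 1 => haagerup (haagerupPower n) (continuousOpSpace G)

/-- The elementary tensor `φ 0 ⊗ φ 1 ⊗ ⋯ ⊗ φ n`. -/
def elementaryTensor {G : Type u} [TopologicalSpace G] [CompactSpace G] :
    ∀ n : ℕ, (Fin (n + 1) → C(G, ℂ)) → (haagerupPower G n).carrier
  | 0, φ => φ 0
  | n + 1, φ => elementaryTensor n (fun i => φ i.castSucc) ⊗ₜ[ℂ] φ (Fin.last (n + 1))

/-- The Banach space `V^n(G)`, the completed Haagerup tensor product of `n + 1` copies of `C(G)`. -/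
abbrev V : Type u := UniformSpace.Completion (haagerupPower G n).carrier

end V

end

end Varopoulos

/-! Submultiplicativity is proved at the level of matrices. On `C(G)` the Kronecker product of
matrices, with entries multiplied pointwise, is contractive, because at each point it is a Kronecker
product of scalar matrices. This property passes to Haagerup tensor products: the Kronecker product
of `x ⊙ y` and `z ⊙ w` is the `⊙` product of the Kronecker products of `x, z` and of `y, w`. By
induction it holds for every `haagerupPower G n`, and `1 × 1` matrices give `‖uv‖ ≤ ‖u‖ ‖v‖`.

Evaluation as a function on `G^{n+1}` is contractive because slicing the last factor at a point `t`
is contractive. The delicate point is that its extension to the completion stays injective. The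
positive finite rank maps `f ↦ ∑ f(t_j) ρ_j`, with `ρ` a partition of unity, are contractive on all
matrices over `C(G)`. Their amplifications to `E ⊗ C(G)` are therefore contractions, and they
approximate each tensor in Haagerup norm. The amplified tensor depends on only finitely many slices,
so a Cauchy sequence whose slices tend to zero tends to zero. Induction on `n` then shows that a
Cauchy sequence of tensors whose functions tend to zero uniformly tends to zero in norm
(`tendsto_zero_of_powerEval`), which is injectivity on the completion.

Finally the multiplication extends to the completion by continuity, and the ring axioms are read off
in `C(G^{n+1})` through the injective evaluation. -/

namespace Varopoulos

noncomputable section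

/-! ### Haagerup tensors -/

section Tensors

variable {E F : OpSpace.{u}}

/-- An elementary tensor, as an element of the Haagerup tensor product. -/
def tmul (a : E.carrier) (b : F.carrier) : (haagerup E F).carrier := a ⊗ₜ[ℂ] b

theorem tmul_induction {P : (haagerup E F).carrier → Prop} (zero : P 0)
    (tmul : ∀ a b, P (tmul a b)) (add : ∀ u v, P u → P v → P (u + v)) (u) : P u :=
  TensorProduct.induction_on (motive := P) u zero tmul add

theorem exists_sum_tmul_of_lt {u : (haagerup E F).carrier} {c : ℝ} (h : ‖u‖ < c) :
    ∃ (r : ℕ) (x : Matrix (Fin 1) (Fin r) E.carrier) (y : Matrix (Fin r) (Fin 1) F.carrier),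
      u = ∑ k, tmul (x 0 k) (y k 0) ∧ E.mnorm x ≤ √c ∧ F.mnorm y ≤ √c := by
  obtain ⟨r, x, y, hu, hx, hy⟩ := exists_odot_of_lt (E := E) (F := F)
    (U := OpSpace.single u) (c := c) h
  exact ⟨r, x, y, congrFun (congrFun hu 0) 0, hx, hy⟩

/-- To bound a map on a Haagerup tensor product it suffices to consider products of rows and
columns. -/
theorem norm_le_of_sum_tmul {M : Type*} [SeminormedAddCommGroup M]
    (f : (haagerup E F).carrier → M)
    (h : ∀ (r : ℕ) (x : Matrix (Fin 1) (Fin r) E.carrier) (y : Matrix (Fin r) (Fin 1) F.carrier),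
      ‖f (∑ k, tmul (x 0 k) (y k 0))‖ ≤ E.mnorm x * F.mnorm y) (u : (haagerup E F).carrier) :
    ‖f u‖ ≤ ‖u‖ := by
  refine le_of_forall_gt_imp_ge_of_dense fun c hc => ?_
  obtain ⟨r, x, y, rfl, hx, hy⟩ := exists_sum_tmul_of_lt hc
  refine (h r x y).trans ?_
  rw [← Real.mul_self_sqrt ((norm_nonneg _).trans (le_of_lt hc))]
  exact mul_le_mul hx hy (F.mnorm_nonneg _) (Real.sqrt_nonneg _)

theorem norm_sum_tmul_le {r : ℕ} (x : Matrix (Fin 1) (Fin r) E.carrier)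
    (y : Matrix (Fin r) (Fin 1) F.carrier) :
    ‖∑ k, tmul (x 0 k) (y k 0)‖ ≤ E.mnorm x * F.mnorm y := by
  have h : OpSpace.single (∑ k, tmul (x 0 k) (y k 0)) = odot x y := by
    ext i j
    rw [Subsingleton.elim i 0, Subsingleton.elim j 0]; rfl
  exact (congrArg (haagerupNorm E F) h).trans_le (haagerupNorm_odot_le x y)

theorem norm_tmul_le (a : E.carrier) (b : F.carrier) : ‖tmul a b‖ ≤ ‖a‖ * ‖b‖ := by
  have h := norm_sum_tmul_le (OpSpace.single a) (OpSpace.single b)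
  rwa [Fin.sum_univ_one] at h

end Tensors

/-! ### Kronecker products and multiplication -/

/-- The Kronecker product of matrices, with respect to a bilinear map. -/
def kron {X Y Z : Type u} [AddCommGroup X] [Module ℂ X] [AddCommGroup Y] [Module ℂ Y]
    [AddCommGroup Z] [Module ℂ Z] (m : X →ₗ[ℂ] Y →ₗ[ℂ] Z) {p q p' q' : ℕ}
    (x : Matrix (Fin p) (Fin q) X) (y : Matrix (Fin p') (Fin q') Y) :
    Matrix (Fin (p * p')) (Fin (q * q')) Z :=
  fun i j => m (x (finProdFinEquiv.symm i).1 (finProdFinEquiv.symm j).1)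
    (y (finProdFinEquiv.symm i).2 (finProdFinEquiv.symm j).2)

theorem sum_finProdFinEquiv {p q : ℕ} {M : Type*} [AddCommMonoid M] (f : Fin p × Fin q → M) :
    ∑ i : Fin (p * q), f (finProdFinEquiv.symm i) = ∑ a, ∑ b, f (a, b) := by
  rw [Equiv.sum_comp finProdFinEquiv.symm f, Fintype.sum_prod_type]

/-- The matrix acts on a doubly indexed vector by `β` in the second index followed by `α` in the
first. Each of these actions is bounded separately, with the other index frozen, after summing
squares. -/
theorem opNorm_kron_le {p q p' q' : ℕ} (α : Matrix (Fin p) (Fin q) ℂ)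
    (β : Matrix (Fin p') (Fin q') ℂ) :
    opNorm (kron (LinearMap.mul ℂ ℂ) α β) ≤ opNorm α * opNorm β := by
  refine opNorm_le_of_sq _ _ (mul_nonneg (opNorm_nonneg _) (opNorm_nonneg _)) fun v => ?_
  -- The vector `v` viewed as a `q × q'` array.
  set w : Fin q → Fin q' → ℂ := fun a b => v (finProdFinEquiv (a, b)) with hw
  have hv : ∀ j, v j = w (finProdFinEquiv.symm j).1 (finProdFinEquiv.symm j).2 := fun j => by
    simp only [hw, Prod.mk.eta, Equiv.apply_symm_apply]
  have hmul : ∀ i, (kron (LinearMap.mul ℂ ℂ) α β).mulVec v i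
      = α.mulVec (fun a => β.mulVec (w a) (finProdFinEquiv.symm i).2)
        (finProdFinEquiv.symm i).1 := fun i => by
    simp only [Matrix.mulVec, dotProduct, kron, hv, LinearMap.mul_apply']
    rw [sum_finProdFinEquiv (fun c => α (finProdFinEquiv.symm i).1 c.1
      * β (finProdFinEquiv.symm i).2 c.2 * w c.1 c.2)]
    refine Finset.sum_congr rfl fun a _ => ?_
    rw [Finset.mul_sum]
    exact Finset.sum_congr rfl fun b _ => mul_assoc _ _ _
  simp only [hmul, hv]
  rw [sum_finProdFinEquiv (fun c => ‖α.mulVec (fun a => β.mulVec (w a) c.2) c.1‖ ^ 2),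
    sum_finProdFinEquiv (fun c => ‖w c.1 c.2‖ ^ 2), Finset.sum_comm]
  calc _ ≤ ∑ b, opNorm α ^ 2 * ∑ a, ‖β.mulVec (w a) b‖ ^ 2 :=
        Finset.sum_le_sum fun b _ => sq_le_opNorm α _
    _ = opNorm α ^ 2 * ∑ a, ∑ b, ‖β.mulVec (w a) b‖ ^ 2 := by
        rw [← Finset.mul_sum, Finset.sum_comm]
    _ ≤ opNorm α ^ 2 * ∑ a, opNorm β ^ 2 * ∑ b, ‖w a b‖ ^ 2 := by
        gcongr with a _
        exact sq_le_opNorm β _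
    _ = _ := by rw [← Finset.mul_sum, mul_pow, mul_assoc]

/-- A bilinear map on an operator space is contractive for Kronecker products of matrices. -/
def KronContractive (E : OpSpace.{u}) (m : E.carrier →ₗ[ℂ] E.carrier →ₗ[ℂ] E.carrier) : Prop :=
  ∀ {p q p' q' : ℕ} (x : Matrix (Fin p) (Fin q) E.carrier) (y : Matrix (Fin p') (Fin q') E.carrier),
    E.mnorm (kron m x y) ≤ E.mnorm x * E.mnorm y

theorem KronContractive.norm_le {E : OpSpace.{u}}
    {m : E.carrier →ₗ[ℂ] E.carrier →ₗ[ℂ] E.carrier} (h : KronContractive E m) (a b : E.carrier) :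
    ‖m a b‖ ≤ ‖a‖ * ‖b‖ :=
  h (OpSpace.single a) (OpSpace.single b)

/-- Pointwise multiplication on the operator space `C(K)`. -/
def continuousMul (K : Type u) [TopologicalSpace K] [CompactSpace K] :
    (continuousOpSpace K).carrier →ₗ[ℂ] (continuousOpSpace K).carrier →ₗ[ℂ]
      (continuousOpSpace K).carrier :=
  LinearMap.mul ℂ C(K, ℂ)

theorem kronContractive_continuousMul (K : Type u) [TopologicalSpace K] [CompactSpace K] :
    KronContractive (continuousOpSpace K) (continuousMul K) := by
  intro p q p' q' x y
  refine matrixSupNorm_le K _ (mul_nonneg (matrixSupNorm_nonneg K x) (matrixSupNorm_nonneg K y))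
    fun s => ?_
  have : evalMatrix (kron (continuousMul K) x y) s
      = kron (LinearMap.mul ℂ ℂ) (evalMatrix x s) (evalMatrix y s) := rfl
  rw [this]
  exact (opNorm_kron_le _ _).trans (mul_le_mul (opNorm_evalMatrix_le K x s)
    (opNorm_evalMatrix_le K y s) (opNorm_nonneg _) (matrixSupNorm_nonneg K x))

/-- The multiplication on a tensor product. -/
def haagerupMul {E F : OpSpace.{u}} (m : E.carrier →ₗ[ℂ] E.carrier →ₗ[ℂ] E.carrier)
    (m' : F.carrier →ₗ[ℂ] F.carrier →ₗ[ℂ] F.carrier) :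
    (haagerup E F).carrier →ₗ[ℂ] (haagerup E F).carrier →ₗ[ℂ] (haagerup E F).carrier :=
  TensorProduct.map₂ m m'

theorem haagerupMul_tmul {E F : OpSpace.{u}} (m : E.carrier →ₗ[ℂ] E.carrier →ₗ[ℂ] E.carrier)
    (m' : F.carrier →ₗ[ℂ] F.carrier →ₗ[ℂ] F.carrier) (a c : E.carrier) (b d : F.carrier) :
    haagerupMul m m' (tmul a b) (tmul c d) = tmul (m a c) (m' b d) := rfl

/-- Factor `U = x ⊙ y` and `V = z ⊙ w` almost optimally. The pairs of inner indices, running over `r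
* s`, give a factorization of the Kronecker product whose row and column factors are again Kronecker
products. These inner matrices are why the hypothesis is needed for all matrix sizes, and not only
for elements. -/
theorem KronContractive.haagerupMul {E F : OpSpace.{u}}
    {m : E.carrier →ₗ[ℂ] E.carrier →ₗ[ℂ] E.carrier}
    {m' : F.carrier →ₗ[ℂ] F.carrier →ₗ[ℂ] F.carrier} (h : KronContractive E m)
    (h' : KronContractive F m') : KronContractive (haagerup E F) (haagerupMul m m') := by
  intro p q p' q' U V
  have key : ∀ c > haagerupNorm E F U, ∀ d > haagerupNorm E F V,
      haagerupNorm E F (kron (Varopoulos.haagerupMul m m') U V) ≤ c * d := by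
    intro c hc d hd
    have hc0 : 0 ≤ c := (haagerupNorm_nonneg U).trans (le_of_lt hc)
    have hd0 : 0 ≤ d := (haagerupNorm_nonneg V).trans (le_of_lt hd)
    obtain ⟨r, x, y, rfl, hx, hy⟩ := exists_odot_of_lt hc
    obtain ⟨s, z, w, rfl, hz, hw⟩ := exists_odot_of_lt hd
    have : kron (Varopoulos.haagerupMul m m') (odot x y) (odot z w)
        = odot (kron m x z) (kron m' y w) := by
      ext i j
      refine Eq.trans ?_ (sum_finProdFinEquiv (M := (haagerup E F).carrier) fun c => tmul
        (m (x _ c.1) (z _ c.2)) (m' (y c.1 _) (w c.2 _))).symm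
      change Varopoulos.haagerupMul m m' (∑ k, tmul (x _ k) (y k _)) (∑ k, tmul (z _ k) (w k _))
        = _
      rw [LinearMap.map_sum₂]
      refine Finset.sum_congr rfl fun a _ => ?_
      rw [map_sum]
      exact Finset.sum_congr rfl fun b _ => haagerupMul_tmul _ _ _ _ _ _
    rw [this]
    refine (haagerupNorm_odot_le _ _).trans ?_
    calc _ ≤ (√c * √d) * (√c * √d) := by
          refine mul_le_mul ((h x z).trans ?_) ((h' y w).trans ?_) (F.mnorm_nonneg _) (by positivity)
          · exact mul_le_mul hx hz (E.mnorm_nonneg _) (Real.sqrt_nonneg _)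
          · exact mul_le_mul hy hw (F.mnorm_nonneg _) (Real.sqrt_nonneg _)
      _ = c * d := by
          rw [mul_mul_mul_comm, Real.mul_self_sqrt hc0, Real.mul_self_sqrt hd0]
  change haagerupNorm E F _ ≤ haagerupNorm E F U * haagerupNorm E F V
  -- Take `c` and `d` to be the two norms plus `ε`, and let `ε` decrease to `0`.
  refine ge_of_tendsto (x := nhdsWithin (0 : ℝ) (Set.Ioi 0))
    (f := fun ε => (haagerupNorm E F U + ε) * (haagerupNorm E F V + ε)) ?_ ?_
  · have : Continuous fun ε : ℝ => (haagerupNorm E F U + ε) * (haagerupNorm E F V + ε) := by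
      fun_prop
    simpa using (this.tendsto 0).mono_left nhdsWithin_le_nhds
  · refine eventually_nhdsWithin_of_forall fun ε hε => ?_
    exact key _ (lt_add_of_pos_right _ hε) _ (lt_add_of_pos_right _ hε)

/-! ### Slice maps on a tensor product with `C(K)` -/

section Slice

variable {K : Type u} [TopologicalSpace K] [CompactSpace K] (E : OpSpace.{u})

variable (K) in
/-- The underlying space of the operator space `C(K)`. -/
abbrev CSpace : Type u := (continuousOpSpace K).carrier

/-- Evaluation at a point of `K`. -/
def evalAt (t : K) : CSpace K →ₗ[ℂ] ℂ := (ContinuousMap.evalCLM ℂ t : C(K, ℂ) →L[ℂ] ℂ).toLinearMap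

/-- The slice map `x ⊗ f ↦ f t • x`. -/
def sliceMap (t : K) : (haagerup E (continuousOpSpace K)).carrier →ₗ[ℂ] E.carrier :=
  (TensorProduct.rid ℂ E.carrier).toLinearMap ∘ₗ
    LinearMap.lTensor E.carrier (evalAt t)

theorem sliceMap_tmul (t : K) (x : E.carrier) (f : CSpace K) :
    sliceMap E t (tmul x f) = evalAt t f • x :=
  TensorProduct.rid_tmul _ _

variable {E}

/-- Slicing `x ⊙ y` at `t` gives the row `x` times the scalar column `y(t)`, so Ruan's axiom for
scalar multiplication applies. -/
theorem norm_sliceMap_le (t : K) (u : (haagerup E (continuousOpSpace K)).carrier) :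
    ‖sliceMap E t u‖ ≤ ‖u‖ := by
  refine norm_le_of_sum_tmul _ (fun r x y => ?_) u
  have h : OpSpace.single (sliceMap E t (∑ k, tmul (x 0 k) (y k 0)))
      = scalarMul 1 x (evalMatrix y t) := by
    ext i j
    rw [Subsingleton.elim i 0, Subsingleton.elim j 0]
    refine (map_sum (sliceMap E t) _ _).trans ?_
    simp only [scalarMul, Fin.sum_univ_one, Matrix.one_apply_eq, one_mul]
    exact Finset.sum_congr rfl fun k _ => sliceMap_tmul E t _ _
  change E.mnorm (OpSpace.single _) ≤ _
  rw [h]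
  refine (E.mnorm_scalarMul_le _ _ _).trans (mul_le_mul ?_ (opNorm_evalMatrix_le K y t)
    (opNorm_nonneg _) (E.mnorm_nonneg _))
  exact mul_le_of_le_one_left (E.mnorm_nonneg _) opNorm_one_le

end Slice

/-! ### Approximation by finite rank maps -/

section Approx

variable {K : Type u} [TopologicalSpace K] {ι : Type*} [Fintype ι]

theorem sum_partition (ρ : PartitionOfUnity ι K) (s : K) : ∑ j, ρ j s = 1 := by
  rw [← finsum_eq_sum_of_fintype, ρ.sum_eq_one (Set.mem_univ s)]

-- A convex combination of matrices obeys a common norm bound. Only the indices active at `s` have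
-- to satisfy it, which lets bounds valid just on the supports of the `ρ j` be used.
open scoped Matrix.Norms.L2Operator in
theorem opNorm_sum_partition_le (ρ : PartitionOfUnity ι K) {p q : ℕ}
    (A : ι → Matrix (Fin p) (Fin q) ℂ) (s : K) {c : ℝ} (h : ∀ j, ρ j s ≠ 0 → opNorm (A j) ≤ c) :
    opNorm (∑ j, (ρ j s : ℂ) • A j) ≤ c := by
  rw [← one_mul c, ← sum_partition ρ s, Finset.sum_mul]
  refine (norm_sum_le Finset.univ fun j => (ρ j s : ℂ) • A j).trans
    (Finset.sum_le_sum fun j _ => ?_)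
  rw [norm_smul (ρ j s : ℂ) (A j), Complex.norm_real, Real.norm_of_nonneg (ρ.nonneg j s)]
  rcases eq_or_ne (ρ j s) 0 with h0 | h0
  · simp [h0]
  · exact mul_le_mul_of_nonneg_left (h j h0) (ρ.nonneg j s)

variable [CompactSpace K]

/-- A real function as an element of the operator space `C(K)`. -/
def ofRealMap (f : C(K, ℝ)) : CSpace K := (⟨fun s => (f s : ℂ), by fun_prop⟩ : C(K, ℂ))

/-- The finite rank operator `f ↦ ∑ j, f (t j) • ρ j` on `C(K)`. -/
def approx (ρ : PartitionOfUnity ι K) (t : ι → K) : CSpace K →ₗ[ℂ] CSpace K :=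
  ∑ j, (evalAt (t j)).smulRight (ofRealMap (ρ j))

theorem approx_apply (ρ : PartitionOfUnity ι K) (t : ι → K) (f : CSpace K) :
    approx ρ t f = ∑ j, evalAt (t j) f • ofRealMap (ρ j) := by
  simp [approx]

theorem evalMatrix_approx (ρ : PartitionOfUnity ι K) (t : ι → K) {p q : ℕ}
    (y : Matrix (Fin p) (Fin q) (CSpace K)) (s : K) :
    evalMatrix (y.map (approx ρ t)) s = ∑ j, (ρ j s : ℂ) • evalMatrix y (t j) := by
  ext a b
  change evalAt s (approx ρ t (y a b)) = _
  rw [approx_apply, map_sum, Matrix.sum_apply]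
  exact Finset.sum_congr rfl fun j _ => ((evalAt s).map_smul _ _).trans (mul_comm _ _)

/-- Each value of the new matrix function is a convex combination of the values `y(t j)`. The bound
holds for every matrix size, as the Haagerup norm requires. -/
theorem matrixSupNorm_approx_le (ρ : PartitionOfUnity ι K) (t : ι → K) {p q : ℕ}
    (y : Matrix (Fin p) (Fin q) (CSpace K)) :
    matrixSupNorm (y.map (approx ρ t)) ≤ matrixSupNorm y := by
  refine matrixSupNorm_le K _ (matrixSupNorm_nonneg K y) fun s => ?_
  rw [evalMatrix_approx]
  exact opNorm_sum_partition_le ρ _ s fun j _ => opNorm_evalMatrix_le K y (t j)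

-- By compactness, finitely many sets on which `y` is within `ε` of its value at a centre cover `K`.
-- For a partition of unity subordinate to them, the error at `s` is a convex combination of
-- differences `y(s) - y(j)`, each of norm below `ε`.
open scoped Matrix.Norms.L2Operator in
theorem exists_matrixSupNorm_sub_approx_le [T2Space K] {p q : ℕ}
    (y : Matrix (Fin p) (Fin q) (CSpace K)) {ε : ℝ} (hε : 0 < ε) :
    ∃ (T : Finset K) (ρ : PartitionOfUnity T K),
      matrixSupNorm (y - y.map (approx ρ (↑))) ≤ ε := by
  set U : K → Set K := fun t => {s | ‖evalMatrix y s - evalMatrix y t‖ < ε} with hU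
  have hopen : ∀ t, IsOpen (U t) := fun t =>
    isOpen_lt (((evalMatrix y).continuous.sub continuous_const).norm) continuous_const
  obtain ⟨T, hT⟩ := CompactSpace.elim_nhds_subcover U fun t =>
    (hopen t).mem_nhds (by simpa [hU] using hε)
  obtain ⟨ρ, hρ⟩ := PartitionOfUnity.exists_isSubordinate (ι := T) isClosed_univ
    (fun t => U t) (fun t => hopen t) (by
      intro s _
      have : s ∈ ⋃ x ∈ T, U x := hT ▸ Set.mem_univ s
      simpa using this)
  refine ⟨T, ρ, matrixSupNorm_le K _ hε.le fun s => ?_⟩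
  have : evalMatrix (y - y.map (approx ρ (↑))) s
      = ∑ j, (ρ j s : ℂ) • (evalMatrix y s - evalMatrix y j) := by
    have h1 : evalMatrix (y - y.map (approx ρ (↑))) s
        = evalMatrix y s - evalMatrix (y.map (approx ρ (↑))) s := rfl
    rw [h1, evalMatrix_approx]
    simp_rw [smul_sub]
    rw [Finset.sum_sub_distrib, ← Finset.sum_smul, ← Complex.ofReal_sum, sum_partition,
      Complex.ofReal_one, one_smul]
  rw [this]
  refine opNorm_sum_partition_le ρ _ s fun j hj => le_of_lt ?_
  exact hρ j (subset_tsupport _ hj)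

variable (E : OpSpace.{u})

/-- The amplification of `approx` to a Haagerup tensor product. -/
def approxTensor (ρ : PartitionOfUnity ι K) (t : ι → K) :
    (haagerup E (continuousOpSpace K)).carrier →ₗ[ℂ] (haagerup E (continuousOpSpace K)).carrier :=
  LinearMap.lTensor E.carrier (approx ρ t)

variable {E}

theorem approxTensor_tmul (ρ : PartitionOfUnity ι K) (t : ι → K) (x : E.carrier) (f : CSpace K) :
    approxTensor E ρ t (tmul x f)
      = tmul x (approx ρ t f) := rfl

theorem norm_approxTensor_le (ρ : PartitionOfUnity ι K) (t : ι → K)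
    (u : (haagerup E (continuousOpSpace K)).carrier) : ‖approxTensor E ρ t u‖ ≤ ‖u‖ := by
  refine norm_le_of_sum_tmul _ (fun r x y => ?_) u
  rw [map_sum]
  refine (norm_sum_tmul_le (F := continuousOpSpace K) x (Matrix.map y (approx ρ t))).trans ?_
  exact mul_le_mul_of_nonneg_left (matrixSupNorm_approx_le ρ t y) (E.mnorm_nonneg _)

/-- Fix one factorization `u = x ⊙ y`. The error is `x ⊙ (y - approx y)`, so it suffices to
approximate the column `y` as a matrix. -/
theorem exists_norm_sub_approxTensor_le [T2Space K]
    (u : (haagerup E (continuousOpSpace K)).carrier) {ε : ℝ} (hε : 0 < ε) :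
    ∃ (T : Finset K) (ρ : PartitionOfUnity T K), ‖u - approxTensor E ρ (↑) u‖ ≤ ε := by
  obtain ⟨r, x, y, rfl, -, -⟩ := exists_sum_tmul_of_lt (lt_add_one ‖u‖)
  -- The added `1` keeps the divisor positive when `E.mnorm x = 0`.
  have hx : 0 < E.mnorm x + 1 := by linarith [E.mnorm_nonneg x]
  obtain ⟨T, ρ, h⟩ := exists_matrixSupNorm_sub_approx_le y (div_pos hε hx)
  refine ⟨T, ρ, ?_⟩
  have : (∑ k, tmul (x 0 k) (y k 0)) - approxTensor E ρ (↑) (∑ k, tmul (x 0 k) (y k 0))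
      = ∑ k, tmul (x 0 k) ((y - Matrix.map y (approx ρ (↑)) :
        Matrix (Fin r) (Fin 1) (CSpace K)) k 0) := by
    rw [map_sum, ← Finset.sum_sub_distrib]
    exact Finset.sum_congr rfl fun k _ => (TensorProduct.tmul_sub (R := ℂ) _ _ _).symm
  rw [this]
  refine (norm_sum_tmul_le _ _).trans ?_
  calc _ ≤ (E.mnorm x + 1) * (ε / (E.mnorm x + 1)) :=
        mul_le_mul (by linarith) h (matrixSupNorm_nonneg K _) hx.le
    _ = ε := mul_div_cancel₀ _ hx.ne'

/-- The approximation sees only the slices at the points `t j`; this turns information about slices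
into norm estimates. -/
theorem approxTensor_eq_sum (ρ : PartitionOfUnity ι K) (t : ι → K)
    (u : (haagerup E (continuousOpSpace K)).carrier) :
    approxTensor E ρ t u
      = ∑ j, tmul (sliceMap E (t j) u) (ofRealMap (ρ j)) := by
  induction u using tmul_induction with
  | zero =>
    rw [map_zero]
    exact (Finset.sum_eq_zero fun j _ =>
      (congrArg (fun a => tmul a _) (map_zero _)).trans (TensorProduct.zero_tmul _ _)).symm
  | add u v hu hv =>
    rw [map_add, hu, hv, ← Finset.sum_add_distrib]
    refine Finset.sum_congr rfl fun j _ => ?_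
    rw [map_add]
    exact (TensorProduct.add_tmul _ _ _).symm
  | tmul x f =>
    rw [approxTensor_tmul, approx_apply]
    refine (TensorProduct.tmul_sum _ _ _).trans (Finset.sum_congr rfl fun j _ => ?_)
    rw [sliceMap_tmul]
    exact (TensorProduct.smul_tmul _ _ _).symm

/-- A Cauchy sequence whose slices all tend to zero tends to zero. -/
theorem tendsto_zero_of_sliceMap [T2Space K] (v : ℕ → (haagerup E (continuousOpSpace K)).carrier)
    (hv : CauchySeq v)
    (h : ∀ t, Filter.Tendsto (fun N => sliceMap E t (v N)) Filter.atTop (nhds 0)) :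
    Filter.Tendsto v Filter.atTop (nhds 0) := by
  rw [NormedAddGroup.tendsto_nhds_zero]
  intro ε hε
  obtain ⟨N₀, hN₀⟩ := Metric.cauchySeq_iff'.mp hv (ε / 4) (by positivity)
  obtain ⟨T, ρ, hρ⟩ := exists_norm_sub_approxTensor_le (v N₀) (ε := ε / 4) (by positivity)
  -- `T` was fixed by `v N₀` alone, so finitely many slices control the approximations of all later
  -- terms.
  have hlim : Filter.Tendsto (fun N => ∑ j : T, ‖sliceMap E (j : K) (v N)‖
      * ‖ofRealMap (ρ j)‖) Filter.atTop (nhds 0) := by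
    have := tendsto_finsetSum Finset.univ fun (j : T) _ =>
      ((h j).norm.mul_const ‖ofRealMap (ρ j)‖)
    simpa using this
  filter_upwards [hlim.eventually_lt_const (show 0 < ε / 4 by positivity),
    Filter.eventually_ge_atTop N₀] with N h1 h2
  have h3 : ‖approxTensor E ρ (↑) (v N)‖ < ε / 4 := by
    rw [approxTensor_eq_sum]
    exact ((norm_sum_le _ _).trans (Finset.sum_le_sum fun j _ => norm_tmul_le _ _)).trans_lt h1
  have h4 : ‖v N - v N₀‖ < ε / 4 := by simpa [dist_eq_norm] using hN₀ N h2
  have h5 : ‖approxTensor E ρ (↑) (v N₀ - v N)‖ ≤ ‖v N - v N₀‖ := by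
    rw [norm_sub_rev]; exact norm_approxTensor_le _ _ _
  -- The four terms are bounded by `ε / 4` through, in order, the Cauchy property, the approximation
  -- of `v N₀`, contractivity with the Cauchy property, and the slices of `v N`.
  have h6 : v N = (v N - v N₀) + (v N₀ - approxTensor E ρ (↑) (v N₀))
      + approxTensor E ρ (↑) (v N₀ - v N) + approxTensor E ρ (↑) (v N) := by
    rw [map_sub]; abel
  rw [h6]
  refine (norm_add_le _ _).trans_lt ((add_le_add_left norm_add₃_le _).trans_lt ?_)
  linarith

end Approx

/-! ### Completion of a bilinear map -/

section Completion

open UniformSpace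

variable {E : Type u} [SeminormedAddCommGroup E] [NormedSpace ℂ E]

/-- The extension of a contractive bilinear map to the completion. -/
def completionMul (m : E →ₗ[ℂ] E →ₗ[ℂ] E) (hm : ∀ x y, ‖m x y‖ ≤ ‖x‖ * ‖y‖) :
    Completion E →L[ℂ] Completion E →L[ℂ] Completion E :=
  -- One variable is extended at a time, with `flip` exchanging the two.
  (((ContinuousLinearMap.compL ℂ E E (Completion E) Completion.toComplL).comp
    (m.mkContinuous₂ 1 fun x y => by simpa using hm x y)).fromCompletion.flip).fromCompletion.flip

theorem completionMul_coe (m : E →ₗ[ℂ] E →ₗ[ℂ] E) (hm : ∀ x y, ‖m x y‖ ≤ ‖x‖ * ‖y‖) (x y : E) :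
    completionMul m hm (x : Completion E) (y : Completion E) = (m x y : E) := by
  simp [completionMul]

theorem norm_completionMul_le (m : E →ₗ[ℂ] E →ₗ[ℂ] E) (hm : ∀ x y, ‖m x y‖ ≤ ‖x‖ * ‖y‖)
    (u v : Completion E) : ‖completionMul m hm u v‖ ≤ ‖u‖ * ‖v‖ := by
  induction u, v using Completion.induction_on₂ with
  | hp => exact isClosed_le (by fun_prop) (by fun_prop)
  | ih x y =>
    rw [completionMul_coe]
    simpa only [Completion.norm_coe] using hm x y

/-- If a bilinear map on a Banach space is contractive and becomes the multiplication of a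
commutative algebra under an injective map, then it makes the space a Banach algebra. -/
theorem exists_normedCommRing {V : Type u} [NormedAddCommGroup V] [NormedSpace ℂ V]
    [CompleteSpace V] {B : Type*} [CommRing B] [Algebra ℂ B] (m : V →ₗ[ℂ] V →ₗ[ℂ] V)
    (hm : ∀ x y, ‖m x y‖ ≤ ‖x‖ * ‖y‖) (ev : V →ₗ[ℂ] B) (hev : Function.Injective ev)
    (hmul : ∀ x y, ev (m x y) = ev x * ev y) (e : V) (he : ev e = 1) :
    ∃ (A : Type u) (_ : NormedCommRing A) (_ : NormedAlgebra ℂ A) (_ : CompleteSpace A)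
      (i : V ≃ₗᵢ[ℂ] A) (f : A →ₐ[ℂ] B), ∀ x, f (i x) = ev x := by
  -- Associativity, commutativity and the unit laws are checked in `B` by injectivity of `ev`;
  -- distributivity is bilinearity of `m`.
  let ring : NormedCommRing V :=
    { (inferInstance : NormedAddCommGroup V) with
      mul := fun x y => m x y
      one := e
      mul_assoc := fun x y z => hev (by
        change ev (m (m x y) z) = ev (m x (m y z))
        simp only [hmul, mul_assoc])
      one_mul := fun x => hev (by
        change ev (m e x) = ev x
        rw [hmul, he, one_mul])
      mul_one := fun x => hev (by
        change ev (m x e) = ev x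
        rw [hmul, he, mul_one])
      mul_comm := fun x y => hev (by
        change ev (m x y) = ev (m y x)
        rw [hmul, hmul, mul_comm])
      left_distrib := fun x y z => map_add (m x) y z
      right_distrib := fun x y z => LinearMap.map_add₂ m x y z
      zero_mul := fun x => LinearMap.map_zero₂ m x
      mul_zero := fun x => map_zero (m x)
      norm_mul_le := hm }
  let alg : Algebra ℂ V := Algebra.ofModule
    (fun c x y => LinearMap.map_smul₂ m c x y) (fun c x y => map_smul (m x) c y)
  let nalg : NormedAlgebra ℂ V := { alg with norm_smul_le := norm_smul_le }
  exact ⟨V, ring, nalg, inferInstance, LinearIsometryEquiv.refl ℂ V,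
    AlgHom.ofLinearMap ev he hmul, fun x => rfl⟩

end Completion

/-! ### The Haagerup powers of `C(G)` as function algebras -/

section Powers

variable {G : Type u} [TopologicalSpace G] [CompactSpace G]

variable (G) in
/-- Pointwise multiplication on `C(G) ⊗ ⋯ ⊗ C(G)`. -/
def powerMul : ∀ n : ℕ, (haagerupPower G n).carrier →ₗ[ℂ] (haagerupPower G n).carrier →ₗ[ℂ]
    (haagerupPower G n).carrier
  | 0 => continuousMul G
  | n + 1 => haagerupMul (powerMul n) (continuousMul G)

theorem kronContractive_powerMul : ∀ n : ℕ, KronContractive (haagerupPower G n) (powerMul G n)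
  | 0 => kronContractive_continuousMul G
  | n + 1 => KronContractive.haagerupMul (kronContractive_powerMul n) (kronContractive_continuousMul G)

variable (G) in
/-- The map sending an elementary tensor to the product function on `G^{n+1}`. -/
def powerEval : ∀ n : ℕ, (haagerupPower G n).carrier →ₗ[ℂ] C(Fin (n + 1) → G, ℂ)
  | 0 => (ContinuousMap.compRightAlgHom ℂ ℂ
      (⟨fun s => s 0, by fun_prop⟩ : C(Fin 1 → G, G))).toLinearMap
  | n + 1 => TensorProduct.lift ((LinearMap.mul ℂ C(Fin (n + 1 + 1) → G, ℂ)).compl₁₂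
      ((ContinuousMap.compRightAlgHom ℂ ℂ (⟨fun s i => s i.castSucc, by fun_prop⟩ :
        C(Fin (n + 1 + 1) → G, Fin (n + 1) → G))).toLinearMap ∘ₗ powerEval n)
      (ContinuousMap.compRightAlgHom ℂ ℂ (⟨fun s => s (Fin.last (n + 1)), by fun_prop⟩ :
        C(Fin (n + 1 + 1) → G, G))).toLinearMap)

theorem power_induction {n : ℕ} {P : (haagerupPower G (n + 1)).carrier → Prop} (zero : P 0)
    (tmul : ∀ (x : (haagerupPower G n).carrier) (f : CSpace G), P (tmul x f))
    (add : ∀ u v, P u → P v → P (u + v)) (u) : P u :=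
  tmul_induction zero tmul add u

theorem powerEval_tmul (n : ℕ) (x : (haagerupPower G n).carrier) (f : CSpace G)
    (s : Fin (n + 1 + 1) → G) :
    powerEval G (n + 1) (tmul x f) s
      = powerEval G n x (fun i => s i.castSucc) * evalAt (s (Fin.last (n + 1))) f := rfl

theorem powerEval_elementaryTensor : ∀ (n : ℕ) (φ : Fin (n + 1) → C(G, ℂ)) (s : Fin (n + 1) → G),
    powerEval G n (elementaryTensor n φ) s = ∏ i, φ i (s i)
  | 0, φ, s => by
    rw [Fin.prod_univ_one]; rfl
  | n + 1, φ, s => by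
    rw [Fin.prod_univ_castSucc, ← powerEval_elementaryTensor n]; rfl

theorem powerEval_powerMul : ∀ (n : ℕ) (u v : (haagerupPower G n).carrier),
    powerEval G n (powerMul G n u v) = powerEval G n u * powerEval G n v
  | 0, _, _ => rfl
  | n + 1, u, v => by
    induction u using power_induction with
    | zero => rw [LinearMap.map_zero₂, map_zero, zero_mul]
    | add u u' hu hu' => rw [LinearMap.map_add₂, map_add, map_add, hu, hu', add_mul]
    | tmul x f =>
      induction v using power_induction with
      | zero => rw [map_zero, map_zero, mul_zero]
      | add v v' hv hv' => rw [map_add, map_add, map_add, hv, hv', mul_add]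
      | tmul y g =>
        ext s
        change powerEval G (n + 1) (tmul (powerMul G n x y) (continuousMul G f g)) s
          = powerEval G (n + 1) (tmul x f) s * powerEval G (n + 1) (tmul y g) s
        rw [powerEval_tmul, powerEval_tmul, powerEval_tmul, powerEval_powerMul n,
          ContinuousMap.mul_apply, mul_mul_mul_comm]
        rfl

/-- The slice map on the last tensor factor. -/
def powerSlice (n : ℕ) (t : G) :
    (haagerupPower G (n + 1)).carrier →ₗ[ℂ] (haagerupPower G n).carrier :=
  sliceMap (haagerupPower G n) t

theorem powerSlice_tmul (n : ℕ) (t : G) (x : (haagerupPower G n).carrier) (f : CSpace G) :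
    powerSlice n t (tmul x f) = evalAt t f • x :=
  sliceMap_tmul _ t x f

theorem norm_powerSlice_le (n : ℕ) (t : G) (u : (haagerupPower G (n + 1)).carrier) :
    ‖powerSlice n t u‖ ≤ ‖u‖ :=
  norm_sliceMap_le t u

/-- Freezing the last coordinate of the function amounts to slicing the tensor; this drives the
inductions on `n`. -/
theorem powerEval_succ_apply (n : ℕ) (u : (haagerupPower G (n + 1)).carrier)
    (s : Fin (n + 1 + 1) → G) :
    powerEval G (n + 1) u s
      = powerEval G n (powerSlice n (s (Fin.last (n + 1))) u) (fun i => s i.castSucc) := by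
  induction u using power_induction with
  | zero => rw [map_zero, map_zero, map_zero]; rfl
  | add u v hu hv =>
    rw [map_add, map_add, map_add, ContinuousMap.add_apply, ContinuousMap.add_apply, hu, hv]
  | tmul x f =>
    rw [powerEval_tmul, powerSlice_tmul, map_smul, ContinuousMap.smul_apply, smul_eq_mul, mul_comm]

theorem norm_evalAt_le (t : G) (f : CSpace G) : ‖evalAt t f‖ ≤ ‖f‖ := by
  refine le_trans ?_ (opNorm_evalMatrix_le G (OpSpace.single f) t)
  have h := sq_le_opNorm (evalMatrix (OpSpace.single (f : C(G, ℂ))) t) 1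
  simp only [Fin.sum_univ_one, Matrix.mulVec, dotProduct, Pi.one_apply, mul_one, norm_one,
    one_pow] at h
  exact le_of_sq_le_sq h (opNorm_nonneg _)

theorem norm_powerEval_le : ∀ (n : ℕ) (u : (haagerupPower G n).carrier),
    ‖powerEval G n u‖ ≤ ‖u‖
  | 0, f => (ContinuousMap.norm_le _ (norm_nonneg _)).mpr fun s => norm_evalAt_le (s 0) f
  | n + 1, u => (ContinuousMap.norm_le _ (norm_nonneg _)).mpr fun s => by
    rw [powerEval_succ_apply]
    exact ((powerEval G n _).norm_coe_le_norm _).trans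
      ((norm_powerEval_le n _).trans (norm_powerSlice_le n _ u))

theorem norm_le_norm_powerEval_zero (f : CSpace G) : ‖f‖ ≤ ‖powerEval G 0 f‖ := by
  refine matrixSupNorm_le G _ (norm_nonneg _) fun t => ?_
  refine opNorm_le_of_sq _ _ (norm_nonneg _) fun v => ?_
  simp only [Fin.sum_univ_one, Matrix.mulVec, dotProduct, ← mul_pow, norm_mul]
  refine pow_le_pow_left₀ (by positivity) (mul_le_mul_of_nonneg_right ?_ (norm_nonneg _)) 2
  exact (powerEval G 0 f).norm_coe_le_norm fun _ => t

/-- Slices of a Cauchy sequence are Cauchy by contractivity, and their functions are restrictions of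
the original ones, hence still tend to zero uniformly. The induction hypothesis handles each slice,
and `tendsto_zero_of_sliceMap` reassembles them. -/
theorem tendsto_zero_of_powerEval [T2Space G] : ∀ (n : ℕ) (v : ℕ → (haagerupPower G n).carrier),
    CauchySeq v → Filter.Tendsto (fun N => powerEval G n (v N)) Filter.atTop (nhds 0) →
      Filter.Tendsto v Filter.atTop (nhds 0)
  | 0, v, _, h => squeeze_zero_norm (fun N => norm_le_norm_powerEval_zero (v N))
      (tendsto_zero_iff_norm_tendsto_zero.mp h)
  | n + 1, v, hv, h => by
    refine tendsto_zero_of_sliceMap v hv fun t => tendsto_zero_of_powerEval n _ ?_ ?_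
    · exact hv.map (AddMonoidHomClass.uniformContinuous_of_bound (powerSlice n t) 1 fun u => by
        simpa using norm_powerSlice_le n t u)
    · refine squeeze_zero_norm (fun N => ?_) (tendsto_zero_iff_norm_tendsto_zero.mp h)
      refine (ContinuousMap.norm_le _ (norm_nonneg _)).mpr fun s => ?_
      have := (powerEval G (n + 1) (v N)).norm_coe_le_norm (Fin.snoc (α := fun _ => G) s t)
      rw [powerEval_succ_apply] at this
      simp only [Fin.snoc_last, Fin.snoc_castSucc] at this
      exact this

variable (G) in
/-- The realization of `V^n(G)` as an algebra of functions on `G^{n+1}`. -/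
def vEval (n : ℕ) : V n G →L[ℂ] C(Fin (n + 1) → G, ℂ) :=
  ((powerEval G n).mkContinuous 1 fun u => by
    simpa using norm_powerEval_le n u).fromCompletion

theorem vEval_coe (n : ℕ) (u : (haagerupPower G n).carrier) :
    vEval G n (u : V n G) = powerEval G n u := by
  simp [vEval]

/-- An element of the kernel is a limit of algebraic tensors. These form a Cauchy sequence whose
functions tend to zero, so the limit is zero. -/
theorem vEval_injective [T2Space G] (n : ℕ) : Function.Injective (vEval G n) := by
  refine (injective_iff_map_eq_zero _).mpr fun w hw => ?_
  obtain ⟨a, ha, hlim⟩ := mem_closure_iff_seq_limit.mp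
    (UniformSpace.Completion.denseRange_coe (α := (haagerupPower G n).carrier) w)
  choose v hv using ha
  have hlim' : Filter.Tendsto (fun N => (v N : V n G)) Filter.atTop (nhds w) := by
    simpa only [hv] using hlim
  have hcauchy : CauchySeq v :=
    (UniformSpace.Completion.isUniformInducing_coe _).cauchy_map_iff.mp hlim'.cauchySeq
  have hev : Filter.Tendsto (fun N => powerEval G n (v N)) Filter.atTop (nhds 0) := by
    have := ((vEval G n).continuous.tendsto w).comp hlim'
    rw [hw] at this
    simpa only [Function.comp_def, vEval_coe] using this
  have h0 := (UniformSpace.Completion.continuous_coe _).tendsto 0 |>.comp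
    (tendsto_zero_of_powerEval n v hcauchy hev)
  exact tendsto_nhds_unique hlim' h0

end Powers

end

end Varopoulos

theorem mainTheorem6 {G : Type u} [Group G] [TopologicalSpace G] [IsTopologicalGroup G]
    [CompactSpace G] [T2Space G] (n : ℕ) :
    ∃ (A : Type u) (_ : NormedCommRing A) (_ : NormedAlgebra ℂ A) (_ : CompleteSpace A)
      (e : Varopoulos.V n G ≃ₗᵢ[ℂ] A) (ev : A →ₐ[ℂ] C(Fin (n + 1) → G, ℂ)),
      Continuous ev ∧ Function.Injective ev ∧
      ∀ (φ : Fin (n + 1) → C(G, ℂ)) (s : Fin (n + 1) → G),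
        ev (e (Varopoulos.elementaryTensor n φ : (Varopoulos.haagerupPower G n).carrier)) s
          = ∏ i, φ i (s i) := by
  have hm := Varopoulos.KronContractive.norm_le (Varopoulos.kronContractive_powerMul (G := G) n)
  obtain ⟨A, _, _, _, e, ev, hev⟩ := Varopoulos.exists_normedCommRing
    ((ContinuousLinearMap.coeLM ℂ).comp (Varopoulos.completionMul _ hm).toLinearMap)
    (Varopoulos.norm_completionMul_le _ hm) (Varopoulos.vEval G n).toLinearMap
    (Varopoulos.vEval_injective n) (fun x y => by
      change Varopoulos.vEval G n (Varopoulos.completionMul _ hm x y)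
        = Varopoulos.vEval G n x * Varopoulos.vEval G n y
      induction x, y using UniformSpace.Completion.induction_on₂ with
      | hp => exact isClosed_eq (by fun_prop) (by fun_prop)
      | ih x y =>
        rw [Varopoulos.completionMul_coe, Varopoulos.vEval_coe, Varopoulos.vEval_coe,
          Varopoulos.vEval_coe, Varopoulos.powerEval_powerMul])
    -- The unit is `1 ⊗ ⋯ ⊗ 1`, whose function is the constant `1`.
    (Varopoulos.elementaryTensor n fun _ => 1 : (Varopoulos.haagerupPower G n).carrier) (by
      ext s
      change Varopoulos.vEval G n _ s = 1
      rw [Varopoulos.vEval_coe, Varopoulos.powerEval_elementaryTensor]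
      simp)
  have hev' : ∀ a, ev a = Varopoulos.vEval G n (e.symm a) := fun a => by
    conv_lhs => rw [← e.apply_symm_apply a, hev]
    rfl
  refine ⟨A, _, _, inferInstance, e, ev, ?_, ?_, fun φ s => ?_⟩
  · rw [show (ev : A → _) = fun a => Varopoulos.vEval G n (e.symm a) from funext hev']
    fun_prop
  · rw [show (ev : A → _) = fun a => Varopoulos.vEval G n (e.symm a) from funext hev']
    exact (Varopoulos.vEval_injective n).comp e.symm.injective
  · rw [hev', e.symm_apply_apply, Varopoulos.vEval_coe, Varopoulos.powerEval_elementaryTensor]
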